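/- Let $d,d_{\mathrm{in}}\in\mathbb{N}$, let $\mathbb{T}^d=(\mathbb{R}/\mathbb{Z})^d$ be the $1$-periodic torus with normalised Lebesgue measure, and let $\sigma:\mathbb{R}\to\mathbb{R}$ be a fixed Lipschitz continuous function. **Architecture.** An output-averaged Fourier neural operator (FNO) with channel width $d_c$, Fourier cut-off $\kappa$ and depth $L$ is a map $\Phi:L^2(\mathbb{T}^d;\mathbb{R}^{d_{\mathrm{in}}})\to\mathbb{R}$ of the form $$\Phi(u)=\frac{1}{|\mathbb{T}^d|}\int_{\mathbb{T}^d} Q\,v_L(x)\,dx,\qquad v_0(x)=P\,u(x),\qquad v_\ell(x)=\sigma\big(W^{(\ell)}v_{\ell-1}(x)+(K^{(\ell)}v_{\ell-1})(x)+b^{(\ell)}\big)\quad(1\le \ell\le L),$$ where $\sigma$ acts componentwise, $P\in\mathbb{R}^{d_c\times d_{\mathrm{in}}}$, $W^{(\ell)}\in\mathbb{R}^{d_c\times d_c}$, $b^{(\ell)}\in\mathbb{R}^{d_c}$, $Q\in\mathbb{R}^{1\times d_c}$, and $$(K^{(\ell)}v)(x)=\operatorname{Re}\sum_{k\in\mathbb{Z}^d,\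 |k|_{\ell^\infty}<\kappa}\hat P^{(\ell)}_k\,\hat v(k)\,e^{2\pi i k\cdot x},\qquad \hat P^{(\ell)}_k\in\mathbb{C}^{d_c\times d_c},$$ with $\hat v(k)$ the $k$-th Fourier coefficient of $v$. Its parameters are the entries of $P$, $W^{(\ell)}$, $\hat P_k^{(\ell)}$, $b^{(\ell)}$, $Q$ (each entry counts once), so that their number is $d_cd_{\mathrm{in}}+L\big(d_c^2+\#\{k\in\mathbb{Z}^d:|k|_{\ell^\infty}<\kappa\}\,d_c^2+d_c\big)+d_c$. They are said to be bounded by $M$ if every real entry, and the real and imaginary parts of every complex entry, are at most $M$ in absolute value. **Approximation rate.** Let $K\subset L^2(\mathbb{T}^d;\mathbb{R}^{d_{\mathrm{in}}})$. A function $G:K\to\mathbb{R}$ *can be approximated by FNOs at logarithmic rate $\gamma$* if there is a sequence $(\Phi_q)_{q\in\mathbb{N}}$ of output-averaged FNOs with activation $\sigma$ such that, for all sufficiently large $q$, $\Phi_q$ has at most $q$ parameters (the architecture may depend on $q$), bounded by $\exp(q)$, and $$\sup_{u\in K}|G(u)-\Phi_q(u)|=O\big(\log(q)^{-\gamma}\big)\qquad(q\to\infty).$$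 **Metric entropy and model class.** For $\epsilon>0$ let $\mathcal{H}(K;\epsilon)=\log_2\mathcal{N}(K;\epsilon)$, where $\mathcal{N}(K;\epsilon)$ is the least number of closed balls of radius $\epsilon$ in $L^2(\mathbb{T}^d;\mathbb{R}^{d_{\mathrm{in}}})$ that cover $K$. Let $\mathrm{Lip}_1(K)$ be the set of all $G:K\to\mathbb{R}$ with $|G(u)|\le 1$ and $|G(u)-G(v)|\le\|u-v\|_{L^2}$ for all $u,v\in K$, with the topology induced by the supremum norm of $C(K)$. **Theorem.** Let $K\subset L^2(\mathbb{T}^d;\mathbb{R}^{d_{\mathrm{in}}})$ be compact and let $\alpha>0$. Assume that there is $c>0$ such that $\mathcal{H}(K;\epsilon)\ge c\,\epsilon^{-1/\alpha}$ for all sufficiently small $\epsilon>0$. Then generic $G\in\mathrm{Lip}_1(K)$ cannot be approximated by FNOs at logarithmic rate $\gamma$ for any $\gamma>\alpha$; that is, the set of all $G\in\mathrm{Lip}_1(K)$ such that for no $\gamma>\alpha$ can $G$ be approximated by FNOs at logarithmic rate $\gamma$ is residual in $\mathrm{Lip}_1(K)$ (it contains a countable intersection of dense open subsets). -/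

import Mathlib

open MeasureTheory Filter Topology

noncomputable section

namespace FNO

/-- The Lebesgue (normalised Haar) measure on the `1`-periodic torus `𝕋^d = (ℝ/ℤ)^d`; it has
total mass one, and it is the measure used by `UnitAddTorus.mFourierCoeff`. -/
abbrev torusMeasure (d : ℕ) : Measure (UnitAddTorus (Fin d)) :=
  Measure.pi fun _ => AddCircle.haarAddCircle

/-- The input space `L²(𝕋^d; ℝ^{d_in})`. -/
abbrev InputSpace (d d_in : ℕ) : Type :=
  Lp (EuclideanSpace ℝ (Fin d_in)) 2 (torusMeasure d)

/-- The Kolmogorov metric entropy: the logarithm to base two of the least number of closed balls of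
radius `ε`, with centres anywhere in the space `X`, that cover `A`. It is meaningful for nonempty
totally bounded `A` and `0 < ε`. -/
def metricEntropy {X : Type*} [PseudoEMetricSpace X] (A : Set X) (ε : ℝ) : ℝ :=
  Real.logb 2 ((Metric.externalCoveringNumber ε.toNNReal A).toNat : ℝ)

/-- The class `Lip₁(K)` of functions `G : K → ℝ` with Lipschitz constant at most one and
`|G| ≤ 1`, as a subset of `C(K, ℝ)`. For compact `K` the topology of `C(K, ℝ)` is the
one given by the supremum norm. -/
def lipOne {X : Type*} [PseudoEMetricSpace X] (K : Set X) : Set C(K, ℝ) :=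
  {G | LipschitzWith 1 G ∧ ∀ u, |G u| ≤ 1}

/-- The retained Fourier modes `k ∈ ℤ^d`, `|k|_{ℓ^∞} < κ`. -/
def modes (d κ : ℕ) : Finset (Fin d → ℤ) :=
  Fintype.piFinset fun _ => Finset.Ioo (-(κ : ℤ)) (κ : ℤ)

/-- The parameters of one hidden layer: the matrix `W`, the Fourier multiplier
`P̂_k ∈ ℂ^{d_c × d_c}` for `|k|_{ℓ^∞} < κ`, and the bias `b`. -/
structure Layer (d d_c κ : ℕ) where
  W : Matrix (Fin d_c) (Fin d_c) ℝ
  multiplier : modes d κ → Matrix (Fin d_c) (Fin d_c) ℂ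
  b : Fin d_c → ℝ

/-- The nonlocal operator `K v = 𝓕⁻¹ (P̂_k 𝓕 v (k))`, where `P̂_k = 0` for `|k|_{ℓ^∞} ≥ κ`.
Hidden states are real, so the real part is taken; it changes nothing when
`P̂_{-k}` is the complex conjugate of `P̂_k`. -/
def Layer.nonlocal {d d_c κ : ℕ} (ℓ : Layer d d_c κ)
    (v : UnitAddTorus (Fin d) → Fin d_c → ℝ) : UnitAddTorus (Fin d) → Fin d_c → ℝ :=
  fun x i => (∑ k : modes d κ,
    (∑ j, ℓ.multiplier k i j * UnitAddTorus.mFourierCoeff (fun y => (v y j : ℂ)) k.1) *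
      UnitAddTorus.mFourier k.1 x).re

/-- The hidden layer `v ↦ σ(W v(x) + (K v)(x) + b)`, `σ` acting componentwise. -/
def Layer.apply {d d_c κ : ℕ} (σ : ℝ → ℝ) (ℓ : Layer d d_c κ)
    (v : UnitAddTorus (Fin d) → Fin d_c → ℝ) : UnitAddTorus (Fin d) → Fin d_c → ℝ :=
  fun x i => σ ((ℓ.W.mulVec (v x)) i + ℓ.nonlocal v x i + ℓ.b i)

/-- All entries of the parameters of the layer are at most `M` in size (for the complex entries:
real and imaginary parts). -/
def Layer.BoundedBy {d d_c κ : ℕ} (ℓ : Layer d d_c κ) (M : ℝ) : Prop :=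
  (∀ i j, |ℓ.W i j| ≤ M) ∧
  (∀ k i j, |(ℓ.multiplier k i j).re| ≤ M ∧ |(ℓ.multiplier k i j).im| ≤ M) ∧
  (∀ i, |ℓ.b i| ≤ M)

end FNO

/-- An output-averaged Fourier neural operator on `L²(𝕋^d; ℝ^{d_in})`: its hyperparameters
(channel width `d_c`, Fourier cut-off `κ`, depth `L`) and a choice of its parameters (lifting
matrix `P`, hidden layers, and the row `Q` of the real-valued linear projection). -/
structure FNO (d d_in : ℕ) where
  d_c : ℕ
  κ : ℕ
  L : ℕ
  P : Matrix (Fin d_c) (Fin d_in) ℝ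
  layer : Fin L → FNO.Layer d d_c κ
  Q : Fin d_c → ℝ

namespace FNO

/-- The number of tunable parameters: `d_c d_in + L (d_c² + #{|k|_{ℓ^∞} < κ} d_c² + d_c) + d_c`.
Every (complex) entry of the Fourier multiplier counts once. -/
def numParams {d d_in : ℕ} (Φ : FNO d d_in) : ℕ :=
  Φ.d_c * d_in + Φ.L * (Φ.d_c ^ 2 + (modes d Φ.κ).card * Φ.d_c ^ 2 + Φ.d_c) + Φ.d_c

/-- The bound `‖θ‖_{ℓ^∞} ≤ M` on the parameters. -/
def BoundedBy {d d_in : ℕ} (Φ : FNO d d_in) (M : ℝ) : Prop :=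
  (∀ i j, |Φ.P i j| ≤ M) ∧ (∀ n, (Φ.layer n).BoundedBy M) ∧ (∀ i, |Φ.Q i| ≤ M)

/-- The last hidden state `𝓛_L ∘ ⋯ ∘ 𝓛_1 ∘ P (u)`. -/
def hidden {d d_in : ℕ} (σ : ℝ → ℝ) (Φ : FNO d d_in) (u : InputSpace d d_in) :
    UnitAddTorus (Fin d) → Fin Φ.d_c → ℝ :=
  Fin.foldl Φ.L (fun v n => (Φ.layer n).apply σ v) fun x => Φ.P.mulVec (u x).ofLp

/-- The output `⨍ Q v(x) dx`, where `v` is the last hidden state. -/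
def eval {d d_in : ℕ} (σ : ℝ → ℝ) (Φ : FNO d d_in) (u : InputSpace d d_in) : ℝ :=
  ⨍ x, Φ.Q ⬝ᵥ Φ.hidden σ u x ∂(torusMeasure d)

/-- `G : K → ℝ` can be approximated, uniformly on `K`, by output-averaged FNOs with activation `σ`
at the logarithmic rate `γ`: there are FNOs `Φ_q` with at most `q` parameters, all of them bounded
by `exp q`, such that `sup_{u ∈ K} |G u - Φ_q u| = O((log q)^(-γ))` as `q → ∞`. -/
def ApproximableAtLogRate {d d_in : ℕ} (σ : ℝ → ℝ) (K : Set (InputSpace d d_in))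
    (G : K → ℝ) (γ : ℝ) : Prop :=
  ∃ Φ : ℕ → FNO d d_in,
    (∀ᶠ q : ℕ in atTop, (Φ q).numParams ≤ q ∧ (Φ q).BoundedBy (Real.exp q)) ∧
    ∃ C : ℝ, ∀ᶠ q : ℕ in atTop, ∀ u : K, |G u - (Φ q).eval σ u| ≤ C * Real.log q ^ (-γ)

end FNO

end

/-!
The theorem compares the size of `Lip₁(K)` with the size of the classes of networks.

A compact set `K` of metric entropy at least `c ε ^ (-1/α)` contains an `ε`-separated set `S` with
at least `2 ^ (c ε ^ (-1/α))` points (`exists_separated_finset`). Bump functions over the subsets of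
`S` (`exists_lipschitz_bumps`) then give `2 ^ #S` functions in `Lip₁(K)` at mutual distance `ε`, and,
after scaling by `δ` and adding `(1 - δ) G₀`, as many functions at mutual distance `δ ε` in a
neighbourhood of any given `G₀`. For `ε` of order `(log q) ^ (-γ)` with `γ > α`, the cardinality of
`S` outgrows every power of `q` (`eventually_exp_lt_two_pow_packing`).

On the other hand, the networks with at most `q` parameters bounded by `exp q` have a uniform
`exp (-q)`-net on `K` with at most `exp (q ^ 4)` elements (`hasSmallNets_networkClass`). Indeed, the
output depends on the parameters with a Lipschitz constant `exp (O(q ^ 2))`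
(`abs_eval_ofParams_sub_le`), so that the parameters can be rounded to multiples of a number
`exp (-O(q ^ 2))`; there are `exp (O(q ^ 3))` rounded networks. The hidden states are measured in
`L¹`: this suffices because a Fourier coefficient is bounded by the `L¹` norm, `σ` is Lipschitz, and
the output is an average.

Hence near every `G₀` there are functions which, for some large `q`, stay at distance more than
`C (log q) ^ (-γ)` from the networks (`dense_farSet`). The set of these functions is open, and the
conclusion holds on the intersection of countably many sets of this kind
(`eventually_residual_not_approximable`).
-/

noncomputable section

namespace FNO

/-! ### Metric entropy, packings and bump functions -/

/-- Lipschitz bumps of height `ε` at the points of a subset `T` of an `ε`-separated set `S`.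
Different subsets `T` give functions at uniform distance `ε`. -/
lemma exists_lipschitz_bumps {Y : Type*} [PseudoMetricSpace Y] {ε : ℝ} (hε : 0 ≤ ε)
    (S : Finset Y) (hS : ∀ x ∈ S, ∀ y ∈ S, x ≠ y → ε ≤ dist x y) (T : Finset Y) (hT : T ⊆ S) :
    ∃ g : Y → ℝ, LipschitzWith 1 g ∧ (∀ u, 0 ≤ g u ∧ g u ≤ ε) ∧ (∀ x ∈ T, g x = ε) ∧
      ∀ x ∈ S, x ∉ T → g x = 0 := by
  classical
  induction T using Finset.induction_on with
  | empty => exact ⟨fun _ => 0, LipschitzWith.const' 0 |>.weaken zero_le_one, by simp [hε],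
      by simp, by simp⟩
  | insert a T ha ih =>
    obtain ⟨g, hg, hb, h1, h0⟩ := ih ((Finset.subset_insert a T).trans hT)
    have haS : a ∈ S := hT (Finset.mem_insert_self a T)
    have hd : LipschitzWith 1 fun u => ε - dist u a := by
      refine LipschitzWith.of_le_add fun x y => ?_
      have := dist_triangle y x a
      rw [dist_comm y x] at this
      linarith
    refine ⟨fun u => max (g u) (ε - dist u a), by simpa using hg.max hd, fun u => ⟨?_, ?_⟩, ?_, ?_⟩
    · exact (hb u).1.trans (le_max_left _ _)
    · exact max_le (hb u).2 (by linarith [dist_nonneg (x := u) (y := a)])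
    · intro x hx
      rcases Finset.mem_insert.1 hx with rfl | hx
      · simpa using (hb x).2
      · simp [h1 x hx, dist_nonneg]
    · intro x hx hxT
      rw [Finset.mem_insert, not_or] at hxT
      have := hS x hx a haS hxT.1
      simp [h0 x hx hxT.2, this]

/-- A compact set contains an `ε`-separated finite set with at least `2 ^ H(ε)` points, where `H`
is its metric entropy. -/
lemma exists_separated_finset {X : Type*} [PseudoMetricSpace X] {K : Set X} (hK : IsCompact K)
    {ε : ℝ} (hε : 0 < ε) (hH : 0 < metricEntropy K ε) :
    ∃ S : Finset K, (∀ x ∈ S, ∀ y ∈ S, x ≠ y → ε ≤ dist x y) ∧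
      (2 : ℝ) ^ metricEntropy K ε ≤ S.card := by
  classical
  set N := Metric.externalCoveringNumber ε.toNNReal K with hN
  have hN0 : (0 : ℝ) < (N.toNat : ℝ) := by
    rcases Nat.eq_zero_or_pos N.toNat with h | h
    · simp [metricEntropy, ← hN, h] at hH
    · exact_mod_cast h
  have hpow : (2 : ℝ) ^ metricEntropy K ε = N.toNat :=
    Real.rpow_logb (by norm_num) (by norm_num) hN0
  have hfin : Metric.packingNumber ε.toNNReal K ≠ ⊤ := by
    have h2 : 2 * (ε / 2).toNNReal = ε.toNNReal := by
      rw [← NNReal.coe_inj]; push_cast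
      rw [Real.coe_toNNReal _ hε.le, Real.coe_toNNReal _ (by positivity)]; ring
    obtain ⟨t, -, htf, ht⟩ := Metric.exists_finite_isCover_of_isCompact
      (ε := (ε / 2).toNNReal) (Real.toNNReal_pos.2 (half_pos hε)).ne' hK
    rw [← h2]
    refine ne_top_of_le_ne_top ?_ ((Metric.packingNumber_two_mul_le_externalCoveringNumber _ _).trans
      ht.externalCoveringNumber_le_encard)
    simpa using htf
  obtain ⟨C, hCK, hCf, hCs, hCc⟩ := Metric.exists_set_encard_eq_packingNumber hfin
  have hle : N ≤ C.encard := hCc ▸ (Metric.externalCoveringNumber_le_coveringNumber _ _).trans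
    (Metric.coveringNumber_le_packingNumber _ _)
  refine ⟨hCf.toFinset.subtype (· ∈ K), fun x hx y hy hxy => ?_, ?_⟩
  · have := hCs (by simpa using hx) (by simpa using hy) (Subtype.coe_ne_coe.2 hxy)
    have h3 : ENNReal.ofReal ε < edist (x : X) y := this
    rw [edist_dist] at h3
    exact (ENNReal.ofReal_lt_ofReal_iff'.1 h3).1.le
  · rw [hpow, Finset.card_subtype, Finset.filter_true_of_mem (fun x hx => hCK (by simpa using hx))]
    rw [hCf.encard_eq_coe_toFinset_card] at hle
    exact_mod_cast ENat.toNat_le_of_le_natCast hle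

/-- At scale `ε = D (log q) ^ (-γ)` with `γ > α`, a packing of cardinality `m = 2 ^ (c ε ^ (-1/α))`
has more subsets than `exp (q ^ 4)`: `m` outgrows every power of `q`, because `ε ^ (-1/α)` is of order `(log q) ^ (γ/α)`. -/
lemma eventually_exp_lt_two_pow_packing {c D α γ : ℝ} (hc : 0 < c) (hD : 0 < D) (hα : 0 < α)
    (hγ : α < γ) :
    ∀ᶠ q : ℕ in atTop, Real.exp ((q : ℝ) ^ 4) <
      (2 : ℝ) ^ ((2 : ℝ) ^ (c * (D * Real.log q ^ (-γ)) ^ (-(1 / α)))) := by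
  have hlog : Tendsto (fun q : ℕ => Real.log q) atTop atTop :=
    Real.tendsto_log_atTop.comp tendsto_natCast_atTop_atTop
  have hs : 0 < γ / α - 1 := by rw [sub_pos, lt_div_iff₀ hα]; linarith
  have hc1 : 0 < c * D ^ (-(1 / α)) := by positivity
  filter_upwards [eventually_ge_atTop 2, hlog.eventually_gt_atTop 0,
    ((tendsto_rpow_atTop hs).comp hlog).eventually_ge_atTop (10 / (c * D ^ (-(1 / α))))]
    with q hq hy hbig
  set y := Real.log q
  have hq2 : (2 : ℝ) ≤ q := by exact_mod_cast hq
  have hq0 : (0 : ℝ) < q := by linarith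
  have hl2 := Real.log_two_gt_d9
  have hexp : 10 * y ≤ c * (D * y ^ (-γ)) ^ (-(1 / α)) := by
    rw [Real.mul_rpow hD.le (by positivity), ← Real.rpow_mul hy.le,
      show -γ * -(1 / α) = (γ / α - 1) + 1 by field_simp; ring, Real.rpow_add hy, Real.rpow_one]
    have h1 : 10 ≤ y ^ (γ / α - 1) * (c * D ^ (-(1 / α))) := (div_le_iff₀ hc1).1 hbig
    nlinarith
  have h5 : (q : ℝ) ^ 5 ≤ (2 : ℝ) ^ (c * (D * y ^ (-γ)) ^ (-(1 / α))) := by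
    calc (q : ℝ) ^ 5 = Real.exp (5 * y) := by
          rw [mul_comm, Real.exp_mul, Real.exp_log hq0]; norm_cast
      _ ≤ (2 : ℝ) ^ (10 * y) := by
          rw [Real.rpow_def_of_pos two_pos]
          exact Real.exp_le_exp.2 (by nlinarith)
      _ ≤ _ := Real.rpow_le_rpow_of_exponent_le one_le_two hexp
  calc Real.exp ((q : ℝ) ^ 4) < (2 : ℝ) ^ ((q : ℝ) ^ 5) := by
        rw [Real.rpow_def_of_pos two_pos]
        refine Real.exp_lt_exp.2 ?_
        have h4 : 0 < (q : ℝ) ^ 4 := by positivity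
        have h1 : 1 < Real.log 2 * q := by nlinarith
        calc (q : ℝ) ^ 4 < q ^ 4 * (Real.log 2 * q) := lt_mul_of_one_lt_right h4 h1
          _ = Real.log 2 * q ^ 5 := by ring
    _ ≤ _ := Real.rpow_le_rpow_of_exponent_le one_le_two h5

/-! ### Generic functions are far from classes with small nets -/

/-- Eventually in `q`, the class `F q` has a uniform `exp (-q)`-net of at most `exp (q ^ 4)`
functions. -/
def HasSmallNets {Y : Type*} (F : ℕ → Set (Y → ℝ)) : Prop :=
  ∀ᶠ q : ℕ in atTop, ∃ t : Finset (Y → ℝ), (t.card : ℝ) ≤ Real.exp ((q : ℝ) ^ 4) ∧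
    ∀ f ∈ F q, ∃ g ∈ t, ∀ u, |f u - g u| ≤ Real.exp (-(q : ℝ))

/-- The `G ∈ Lip₁(K)` which, for some `q ≥ q₀`, stay at uniform distance more than
`C (log q) ^ (-γ)` from the class `F q`. -/
def farSet {X : Type*} [PseudoMetricSpace X] {K : Set X} (F : ℕ → Set (K → ℝ))
    (γ C : ℝ) (q₀ : ℕ) : Set (lipOne K) :=
  {G | ∃ q ≥ q₀, ∃ η > 0, ∀ f ∈ F q, ∃ u : K,
    C * Real.log q ^ (-γ) + η ≤ |(G : C(K, ℝ)) u - f u|}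

lemma isOpen_farSet {X : Type*} [PseudoMetricSpace X] {K : Set X} (hK : IsCompact K)
    (F : ℕ → Set (K → ℝ)) (γ C : ℝ) (q₀ : ℕ) : IsOpen (farSet F γ C q₀) := by
  have : CompactSpace K := isCompact_iff_compactSpace.1 hK
  refine Metric.isOpen_iff.2 ?_
  rintro G ⟨q, hq, η, hη, h⟩
  refine ⟨η / 2, half_pos hη, fun G' hG' => ⟨q, hq, η / 2, half_pos hη, fun f hf => ?_⟩⟩
  obtain ⟨u, hu⟩ := h f hf
  refine ⟨u, ?_⟩
  have h1 : dist ((G' : C(K, ℝ)) u) ((G : C(K, ℝ)) u) < η / 2 :=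
    (ContinuousMap.dist_apply_le_dist u).trans_lt hG'
  rw [Real.dist_eq, abs_sub_comm] at h1
  have h2 := abs_sub_le ((G : C(K, ℝ)) u) ((G' : C(K, ℝ)) u) (f u)
  linarith

/-- Near `G₀ ∈ Lip₁(K)` lie the functions `(1 - δ) G₀ + δ g_T`, with `g_T` the bump functions over
the subsets `T` of an `ε`-separated set. They are `δ ε`-separated, and there are too many of them
for all to be close to `F q`. -/
lemma dense_farSet {X : Type*} [PseudoMetricSpace X] {K : Set X} (hK : IsCompact K)
    {α : ℝ} (hα : 0 < α)
    (hent : ∃ c : ℝ, 0 < c ∧ ∀ᶠ ε : ℝ in 𝓝[>] 0, c * ε ^ (-(1 / α)) ≤ metricEntropy K ε)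
    {F : ℕ → Set (K → ℝ)} (hF : HasSmallNets F) {γ C : ℝ} (hγ : α < γ) (hC : 0 ≤ C) (q₀ : ℕ) :
    Dense (farSet F γ C q₀) := by
  classical
  have : CompactSpace K := isCompact_iff_compactSpace.1 hK
  obtain ⟨c, hc, hent⟩ := hent
  refine Metric.dense_iff.2 fun G₀ ρ hρ => ?_
  obtain ⟨δ, hδ0, hδ1, hδρ⟩ : ∃ δ : ℝ, 0 < δ ∧ δ ≤ 1 ∧ 2 * δ < ρ :=
    ⟨min 1 (ρ / 4), by positivity, min_le_left _ _, by linarith [min_le_right 1 (ρ / 4)]⟩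
  -- `D` makes `δ ε = 2 (C + 2) (log q) ^ (-γ)` for `ε = D (log q) ^ (-γ)`: functions at distance
  -- `δ ε` cannot both be within `(C + 2) (log q) ^ (-γ)` of the same net point.
  set D : ℝ := 2 * (C + 2) / δ with hDdef
  have hD : 0 < D := by positivity
  have hγ0 : 0 < γ := hα.trans hγ
  have hlog : Tendsto (fun q : ℕ => Real.log q) atTop atTop :=
    Real.tendsto_log_atTop.comp tendsto_natCast_atTop_atTop
  have hlim : Tendsto (fun q : ℕ => D * Real.log q ^ (-γ)) atTop (𝓝 0) := by
    simpa using ((tendsto_rpow_neg_atTop hγ0).comp hlog).const_mul D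
  have hpos : ∀ᶠ q : ℕ in atTop, 0 < Real.log q ^ (-γ) := by
    filter_upwards [hlog.eventually_gt_atTop 0] with q hq using Real.rpow_pos_of_pos hq _
  have hlim' : Tendsto (fun q : ℕ => D * Real.log q ^ (-γ)) atTop (𝓝[>] 0) :=
    tendsto_nhdsWithin_iff.2 ⟨hlim, hpos.mono fun q hq => mul_pos hD hq⟩
  have hexp : ∀ᶠ q : ℕ in atTop, Real.exp (-(q : ℝ)) ≤ Real.log q ^ (-γ) := by
    have h := ((isLittleO_log_rpow_atTop (r := 1 / γ) (by positivity)).bound one_pos)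
    have h' := (tendsto_natCast_atTop_atTop (R := ℝ)).eventually h
    filter_upwards [h', hlog.eventually_gt_atTop 0] with q h hq
    have hq0 : (0 : ℝ) ≤ q := by positivity
    rw [Real.norm_of_nonneg hq.le, one_mul, Real.norm_of_nonneg (by positivity)] at h
    have h1 : Real.log q ^ γ ≤ q := by
      calc Real.log q ^ γ ≤ ((q : ℝ) ^ (1 / γ)) ^ γ := Real.rpow_le_rpow hq.le h hγ0.le
        _ = q := by rw [← Real.rpow_mul hq0]; simp [hγ0.ne']
    rw [Real.rpow_neg hq.le, Real.exp_neg]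
    exact inv_anti₀ (Real.rpow_pos_of_pos hq _) (by linarith [Real.add_one_le_exp (q : ℝ)])
  obtain ⟨q, hq, hlarge, ⟨t, htc, ht⟩, he, hpow, hsmall, hle1⟩ :=
    ((eventually_ge_atTop q₀).and <| (eventually_exp_lt_two_pow_packing hc hD hα hγ).and <|
      hF.and <| hexp.and <| hpos.and <| (hlim'.eventually hent).and
        (hlim.eventually_le_const one_pos)).exists
  set r := Real.log q ^ (-γ)
  set ε := D * r with hε
  have hε0 : 0 < ε := mul_pos hD hpow
  obtain ⟨S, hS, hcard⟩ := exists_separated_finset hK hε0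
    (lt_of_lt_of_le (by positivity) hsmall)
  choose g hgL hgb hg1 hg0 using fun T : S.powerset =>
    exists_lipschitz_bumps hε0.le S hS T.1 (Finset.mem_powerset.1 T.2)
  have hG0L : LipschitzWith 1 (G₀ : C(K, ℝ)) := G₀.2.1
  have hG0b : ∀ u, |(G₀ : C(K, ℝ)) u| ≤ 1 := G₀.2.2
  let H : S.powerset → C(K, ℝ) := fun T =>
    ⟨fun u => (1 - δ) * (G₀ : C(K, ℝ)) u + δ * g T u,
      (continuous_const.mul (G₀ : C(K, ℝ)).continuous).add
        (continuous_const.mul (hgL T).continuous)⟩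
  have hHmem : ∀ T, H T ∈ lipOne K := by
    refine fun T => ⟨LipschitzWith.of_dist_le_mul fun u v => ?_, fun u => ?_⟩
    · have h1 := hG0L.dist_le_mul u v
      have h2 := (hgL T).dist_le_mul u v
      simp only [NNReal.coe_one, one_mul, Real.dist_eq, abs_le] at h1 h2
      simp only [NNReal.coe_one, one_mul, Real.dist_eq, H, ContinuousMap.coe_mk, abs_le]
      constructor <;> nlinarith
    · have h1 := abs_le.1 (hG0b u)
      have h2 := hgb T u
      simp only [H, ContinuousMap.coe_mk, abs_le]
      constructor <;> nlinarith
  have hHdist : ∀ T, dist (H T) (G₀ : C(K, ℝ)) < ρ := by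
    refine fun T => lt_of_le_of_lt ((ContinuousMap.dist_le (by positivity)).2 fun u => ?_) hδρ
    have h1 := abs_le.1 (hG0b u)
    have h2 := hgb T u
    simp only [H, ContinuousMap.coe_mk, Real.dist_eq, abs_le]
    constructor <;> nlinarith
  by_contra hcon
  -- Otherwise `F q` is within `(C + 1) r` of every `H T`, and the net within `(C + 2) r`.
  have hnear : ∀ T : S.powerset, ∃ k ∈ t, ∀ u, |H T u - k u| < (C + 2) * r := by
    intro T
    have hT : (⟨H T, hHmem T⟩ : lipOne K) ∉ farSet F γ C q₀ := fun hT =>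
      hcon ⟨⟨H T, hHmem T⟩, hHdist T, hT⟩
    simp only [farSet, Set.mem_ofPred_eq, not_exists, not_and, not_forall, not_le] at hT
    obtain ⟨f, hf, hfu⟩ := hT q hq r hpow
    obtain ⟨k, hk, hku⟩ := ht f hf
    refine ⟨k, hk, fun u => ?_⟩
    have h1 := hfu u
    have h2 := (hku u).trans he
    have h3 := abs_sub_le (H T u) (f u) (k u)
    have h4 : |H T u - f u| < C * r + r := h1
    linarith
  choose k hkt hk using hnear
  have hinj : Function.Injective k := by
    intro T T' hTT
    by_contra hne
    obtain ⟨x, hx⟩ : ∃ x, ¬ (x ∈ T.1 ↔ x ∈ T'.1) := by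
      by_contra h
      push Not at h
      exact hne (Subtype.ext (Finset.ext h))
    have hclose : |H T x - H T' x| < δ * ε := by
      have h1 := hk T x
      have h2 := hk T' x
      rw [← hTT, abs_sub_comm] at h2
      have h3 := abs_sub_le (H T x) (k T x) (H T' x)
      have : δ * ε = 2 * ((C + 2) * r) := by rw [hε, hDdef]; field_simp
      linarith
    have heq : H T x - H T' x = δ * (g T x - g T' x) := by
      simp only [H, ContinuousMap.coe_mk]; ring
    rw [heq] at hclose
    have hTS := Finset.mem_powerset.1 T.2
    have hTS' := Finset.mem_powerset.1 T'.2
    by_cases hxT : x ∈ T.1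
    · have hxT' : x ∉ T'.1 := fun h => hx (by simp [hxT, h])
      rw [hg1 T x hxT, hg0 T' x (hTS hxT) hxT', sub_zero, abs_of_pos (by positivity)] at hclose
      exact lt_irrefl _ hclose
    · have hxT' : x ∈ T'.1 := by by_contra h; exact hx (by simp [hxT, h])
      rw [hg1 T' x hxT', hg0 T x (hTS' hxT') hxT, zero_sub, mul_neg, abs_neg,
        abs_of_pos (by positivity)] at hclose
      exact lt_irrefl _ hclose
  have hcount : 2 ^ S.card ≤ t.card := by
    have := Finset.card_le_card_of_injOn (s := Finset.univ) k (fun T _ => hkt T) hinj.injOn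
    simpa using this
  have h1 : (2 : ℝ) ^ ((2 : ℝ) ^ (c * ε ^ (-(1 / α)))) ≤ 2 ^ S.card := by
    rw [← Real.rpow_natCast]
    exact Real.rpow_le_rpow_of_exponent_le one_le_two
      ((Real.rpow_le_rpow_of_exponent_le one_le_two hsmall).trans hcard)
  have h2 : (2 : ℝ) ^ S.card ≤ t.card := by exact_mod_cast hcount
  linarith

/-- Generic functions in `Lip₁(K)` are badly approximated by any sequence of classes that has
small nets. -/
theorem eventually_residual_not_approximable {X : Type*} [PseudoMetricSpace X] {K : Set X}
    (hK : IsCompact K) {α : ℝ} (hα : 0 < α)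
    (hent : ∃ c : ℝ, 0 < c ∧ ∀ᶠ ε : ℝ in 𝓝[>] 0, c * ε ^ (-(1 / α)) ≤ metricEntropy K ε)
    {F : ℕ → Set (K → ℝ)} (hF : HasSmallNets F) :
    ∀ᶠ G : lipOne K in residual (lipOne K), ∀ γ : ℝ, α < γ → ∀ C : ℝ,
      ¬ ∀ᶠ q : ℕ in atTop, ∃ f ∈ F q, ∀ u : K, |(G : C(K, ℝ)) u - f u| ≤ C * Real.log q ^ (-γ) := by
  have key : ∀ᶠ G : lipOne K in residual (lipOne K), ∀ p : ℕ × ℕ × ℕ,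
      G ∈ farSet F (α + 1 / (p.1 + 1)) p.2.1 p.2.2 := by
    refine eventually_countable_forall.2 fun p => residual_of_dense_open
      (isOpen_farSet hK F _ _ _) (dense_farSet hK hα hent hF ?_ (by positivity) _)
    have : (0 : ℝ) < 1 / ((p.1 : ℝ) + 1) := by positivity
    linarith
  filter_upwards [key] with G hG γ hγ C h
  have hlog : Tendsto (fun q : ℕ => Real.log q) atTop atTop :=
    Real.tendsto_log_atTop.comp tendsto_natCast_atTop_atTop
  obtain ⟨m, hm⟩ := exists_nat_one_div_lt (sub_pos.2 hγ)
  obtain ⟨n, hn⟩ := exists_nat_ge C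
  obtain ⟨q₀, hq₀⟩ := eventually_atTop.1 (h.and (hlog.eventually_ge_atTop 1))
  obtain ⟨q, hq, η, hη, hfar⟩ := hG (m, n, q₀)
  obtain ⟨⟨f, hf, hfu⟩, hq1⟩ := hq₀ q hq
  obtain ⟨u, hu⟩ := hfar f hf
  have h1 : C * Real.log q ^ (-γ) ≤ n * Real.log q ^ (-(α + 1 / ((m : ℝ) + 1))) :=
    mul_le_mul hn (Real.rpow_le_rpow_of_exponent_le hq1 (by linarith))
      (Real.rpow_nonneg (by linarith) _) (by positivity)
  have := hfu u
  simp only at hu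
  linarith

/-! ### Fourier coefficients of integrable functions -/

variable {d : ℕ}

lemma norm_mFourier_apply (k : Fin d → ℤ) (x : UnitAddTorus (Fin d)) :
    ‖UnitAddTorus.mFourier k x‖ = 1 := by
  simp only [UnitAddTorus.mFourier, ContinuousMap.coe_mk, norm_prod, fourier_apply,
    Circle.norm_coe, Finset.prod_const_one]

lemma norm_mFourierCoeff_le (v : UnitAddTorus (Fin d) → ℝ) (k : Fin d → ℤ) :
    ‖UnitAddTorus.mFourierCoeff (fun y => (v y : ℂ)) k‖ ≤ ∫ x, |v x| ∂torusMeasure d := by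
  have h : ∀ x, ‖UnitAddTorus.mFourier (-k) x • (v x : ℂ)‖ = |v x| := fun x => by
    rw [norm_smul, norm_mFourier_apply, one_mul, Complex.norm_real, Real.norm_eq_abs]
  refine (norm_integral_le_integral_norm _).trans_eq ?_
  simp only [h]
  rfl

lemma integrable_mFourier_smul {v : UnitAddTorus (Fin d) → ℝ}
    (hv : Integrable v (torusMeasure d)) (k : Fin d → ℤ) :
    Integrable (fun y => UnitAddTorus.mFourier (-k) y • (v y : ℂ)) (torusMeasure d) :=
  Integrable.bdd_smul (𝕜 := ℂ) (β := ℂ) (f := fun y => (v y : ℂ)) hv.ofReal 1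
    (UnitAddTorus.mFourier (-k)).continuous.aestronglyMeasurable
    (ae_of_all _ fun x => (norm_mFourier_apply _ x).le)

lemma mFourierCoeff_sub {v w : UnitAddTorus (Fin d) → ℝ} (hv : Integrable v (torusMeasure d))
    (hw : Integrable w (torusMeasure d)) (k : Fin d → ℤ) :
    UnitAddTorus.mFourierCoeff (fun y => ((v y - w y : ℝ) : ℂ)) k =
      UnitAddTorus.mFourierCoeff (fun y => (v y : ℂ)) k -
        UnitAddTorus.mFourierCoeff (fun y => (w y : ℂ)) k := by
  have := integral_sub (integrable_mFourier_smul hv k) (integrable_mFourier_smul hw k)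
  refine Eq.trans (integral_congr_ae (ae_of_all _ fun y => ?_)) this
  simp [mul_sub]

/-! ### Lipschitz estimates for one layer -/

variable {D κ : ℕ}

/-- Entrywise difference of the parameters of two layers. -/
instance : Sub (Layer d D κ) := ⟨fun ℓ ℓ' =>
  ⟨ℓ.W - ℓ'.W, fun k => ℓ.multiplier k - ℓ'.multiplier k, ℓ.b - ℓ'.b⟩⟩

/-- The linear part `W v + K v` of a layer. -/
def Layer.linear (ℓ : Layer d D κ) (v : UnitAddTorus (Fin d) → Fin D → ℝ) :
    UnitAddTorus (Fin d) → Fin D → ℝ :=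
  fun x i => ℓ.W.mulVec (v x) i + ℓ.nonlocal v x i

/-- The linear part is bilinear in the parameters of the layer and the hidden state. -/
lemma Layer.linear_sub (ℓ ℓ' : Layer d D κ) {v v' : UnitAddTorus (Fin d) → Fin D → ℝ}
    (hv : ∀ j, Integrable (v · j) (torusMeasure d))
    (hv' : ∀ j, Integrable (v' · j) (torusMeasure d)) (x : UnitAddTorus (Fin d)) (i : Fin D) :
    ℓ.linear v x i - ℓ'.linear v' x i = ℓ.linear (v - v') x i + (ℓ - ℓ').linear v' x i := by
  have hW : ℓ.W.mulVec (v x) i - ℓ'.W.mulVec (v' x) i =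
      ℓ.W.mulVec ((v - v') x) i + (ℓ - ℓ').W.mulVec (v' x) i := by
    change _ = ℓ.W.mulVec (v x - v' x) i + (ℓ.W - ℓ'.W).mulVec (v' x) i
    rw [Matrix.mulVec_sub, Matrix.sub_mulVec]
    simp
  have hN : ℓ.nonlocal v x i - ℓ'.nonlocal v' x i =
      ℓ.nonlocal (v - v') x i + (ℓ - ℓ').nonlocal v' x i := by
    simp only [Layer.nonlocal, ← Complex.sub_re, ← Complex.add_re, ← Finset.sum_sub_distrib,
      ← Finset.sum_add_distrib, ← sub_mul, ← add_mul]
    congr 1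
    refine Finset.sum_congr rfl fun k _ => ?_
    congr 1
    refine Finset.sum_congr rfl fun j _ => ?_
    change _ = ℓ.multiplier k i j *
      UnitAddTorus.mFourierCoeff (fun y => ((v y j - v' y j : ℝ) : ℂ)) k +
      (ℓ.multiplier k i j - ℓ'.multiplier k i j) * _
    rw [mFourierCoeff_sub (hv j) (hv' j)]
    ring
  simp only [Layer.linear]
  linarith

lemma Layer.abs_linear_le {ℓ : Layer d D κ} {M : ℝ} (hM : 0 ≤ M) (hℓ : ℓ.BoundedBy M)
    {v : UnitAddTorus (Fin d) → Fin D → ℝ} {B : ℝ}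
    (hB : ∀ j, ∫ x, |v x j| ∂torusMeasure d ≤ B) (x : UnitAddTorus (Fin d)) (i : Fin D) :
    |ℓ.linear v x i| ≤ (∑ j, M * |v x j|) + (modes d κ).card * (D * (2 * M * B)) := by
  have hW : |ℓ.W.mulVec (v x) i| ≤ ∑ j, M * |v x j| := by
    change |∑ j, ℓ.W i j * v x j| ≤ _
    refine (Finset.abs_sum_le_sum_abs _ _).trans (Finset.sum_le_sum fun j _ => ?_)
    rw [abs_mul]
    exact mul_le_mul_of_nonneg_right (hℓ.1 i j) (abs_nonneg _)
  have hN : |ℓ.nonlocal v x i| ≤ (modes d κ).card * (D * (2 * M * B)) := by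
    refine (Complex.abs_re_le_norm _).trans ((norm_sum_le _ _).trans ?_)
    refine (Finset.sum_le_sum (g := fun _ => (D * (2 * M * B) : ℝ)) fun k _ => ?_).trans
      (by simp)
    rw [norm_mul]
    rw [norm_mFourier_apply, mul_one]
    refine (norm_sum_le _ _).trans ?_
    refine (Finset.sum_le_sum (g := fun _ => 2 * M * B) fun j _ => ?_).trans (by simp)
    rw [norm_mul]
    have h2 : ‖ℓ.multiplier k i j‖ ≤ 2 * M := by
      have := hℓ.2.1 k i j
      linarith [Complex.norm_le_abs_re_add_abs_im (ℓ.multiplier k i j), this.1, this.2]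
    exact mul_le_mul h2 ((norm_mFourierCoeff_le _ _).trans (hB j)) (norm_nonneg _) (by positivity)
  exact (abs_add_le _ _).trans (add_le_add hW hN)

lemma Layer.integral_abs_linear_le {ℓ : Layer d D κ} {M : ℝ} (hM : 0 ≤ M) (hℓ : ℓ.BoundedBy M)
    {v : UnitAddTorus (Fin d) → Fin D → ℝ} {B : ℝ}
    (hv : ∀ j, Integrable (v · j) (torusMeasure d))
    (hB : ∀ j, ∫ x, |v x j| ∂torusMeasure d ≤ B) (i : Fin D) :
    ∫ x, |ℓ.linear v x i| ∂torusMeasure d ≤ D * (M * B) + (modes d κ).card * (D * (2 * M * B)) := by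
  have hint : Integrable (fun x => ∑ j, M * |v x j|) (torusMeasure d) :=
    integrable_finsetSum _ fun j _ => (hv j).abs.const_mul M
  refine (integral_mono_of_nonneg (ae_of_all _ fun _ => abs_nonneg _)
    (hint.add (integrable_const _)) (ae_of_all _ fun x => abs_linear_le hM hℓ hB x i)).trans ?_
  rw [integral_add' hint (integrable_const _), integral_finsetSum _ fun j _ =>
    (hv j).abs.const_mul M]
  simp only [integral_const_mul]
  refine add_le_add ((Finset.sum_le_card_nsmul _ _ (M * B) fun j _ =>
    mul_le_mul_of_nonneg_left (hB j) hM).trans_eq (by simp)) (by simp)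

lemma Layer.integrable_linear (ℓ : Layer d D κ) {v : UnitAddTorus (Fin d) → Fin D → ℝ}
    (hv : ∀ j, Integrable (v · j) (torusMeasure d)) (i : Fin D) :
    Integrable (ℓ.linear v · i) (torusMeasure d) := by
  refine Integrable.add ?_ ?_
  · simp only [Matrix.mulVec, dotProduct]
    exact integrable_finsetSum _ fun j _ => (hv j).const_mul _
  · have : Continuous (ℓ.nonlocal v · i) := by
      unfold Layer.nonlocal
      fun_prop
    exact this.integrable_of_hasCompactSupport (HasCompactSupport.of_compactSpace _)

/-- Two hidden states with components of `L¹` norm at most `B`, at distance at most `τ B` in `L¹`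
in each component. -/
structure L1Close (τ B : ℝ) (v v' : UnitAddTorus (Fin d) → Fin D → ℝ) : Prop where
  int : ∀ j, Integrable (v · j) (torusMeasure d)
  int' : ∀ j, Integrable (v' · j) (torusMeasure d)
  le : ∀ j, ∫ x, |v x j| ∂torusMeasure d ≤ B
  le' : ∀ j, ∫ x, |v' x j| ∂torusMeasure d ≤ B
  sub_le : ∀ j, ∫ x, |v x j - v' x j| ∂torusMeasure d ≤ τ * B

lemma integrable_lipschitz_comp {σ : ℝ → ℝ} {Λ : NNReal} (hσ : LipschitzWith Λ σ)
    {f : UnitAddTorus (Fin d) → ℝ} (hf : Integrable f (torusMeasure d)) :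
    Integrable (fun x => σ (f x)) (torusMeasure d) := by
  refine Integrable.mono' ((hf.abs.const_mul Λ).add (integrable_const |σ 0|))
    (hσ.continuous.comp_aestronglyMeasurable hf.1) (ae_of_all _ fun x => ?_)
  have h := hσ.dist_le_mul (f x) 0
  simp only [Real.dist_eq, sub_zero] at h
  have := abs_sub_abs_le_abs_sub (σ (f x)) (σ 0)
  simp only [Real.norm_eq_abs, Pi.add_apply]
  linarith

lemma Layer.integrable_apply {σ : ℝ → ℝ} {Λ : NNReal} (hσ : LipschitzWith Λ σ) (ℓ : Layer d D κ)
    {v : UnitAddTorus (Fin d) → Fin D → ℝ} (hv : ∀ j, Integrable (v · j) (torusMeasure d))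
    (i : Fin D) : Integrable (ℓ.apply σ v · i) (torusMeasure d) :=
  integrable_lipschitz_comp hσ ((ℓ.integrable_linear hv i).add (integrable_const (ℓ.b i)))

lemma Layer.integral_abs_apply_le {σ : ℝ → ℝ} {Λ : NNReal} (hσ : LipschitzWith Λ σ)
    {ℓ : Layer d D κ} {M : ℝ} (hM : 0 ≤ M) (hℓ : ℓ.BoundedBy M)
    {v : UnitAddTorus (Fin d) → Fin D → ℝ} {B : ℝ}
    (hv : ∀ j, Integrable (v · j) (torusMeasure d))
    (hB : ∀ j, ∫ x, |v x j| ∂torusMeasure d ≤ B) (i : Fin D) :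
    ∫ x, |ℓ.apply σ v x i| ∂torusMeasure d ≤
      Λ * (D * (M * B) + (modes d κ).card * (D * (2 * M * B)) + M) + |σ 0| := by
  have hl := ((ℓ.integrable_linear hv i).abs.add (integrable_const M)).const_mul (Λ : ℝ)
  refine (integral_mono_of_nonneg (ae_of_all _ fun _ => abs_nonneg _)
    (hl.add (integrable_const |σ 0|)) (ae_of_all _ fun x => ?_)).trans ?_
  · have h := hσ.dist_le_mul (ℓ.linear v x i + ℓ.b i) 0
    simp only [Real.dist_eq, sub_zero] at h
    have h1 := abs_sub_abs_le_abs_sub (σ (ℓ.linear v x i + ℓ.b i)) (σ 0)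
    have h2 := (abs_add_le (ℓ.linear v x i) (ℓ.b i)).trans (add_le_add_right (hℓ.2.2 i) _)
    have h3 := mul_le_mul_of_nonneg_left h2 Λ.coe_nonneg
    change |σ (ℓ.linear v x i + ℓ.b i)| ≤ Λ * (|ℓ.linear v x i| + M) + |σ 0|
    linarith
  · rw [integral_add' hl (integrable_const _), integral_const_mul,
      integral_add' (ℓ.integrable_linear hv i).abs (integrable_const _)]
    have := integral_abs_linear_le hM hℓ hv hB i
    simp only [integral_const, probReal_univ, smul_eq_mul, one_mul]
    gcongr

lemma Layer.integral_abs_apply_sub_le {σ : ℝ → ℝ} {Λ : NNReal} (hσ : LipschitzWith Λ σ)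
    {ℓ ℓ' : Layer d D κ} {M τ : ℝ} (hM : 0 ≤ M) (hτ : 0 ≤ τ) (hℓ : ℓ.BoundedBy M)
    (hsub : (ℓ - ℓ').BoundedBy τ) {v v' : UnitAddTorus (Fin d) → Fin D → ℝ} {B E : ℝ}
    (hv : ∀ j, Integrable (v · j) (torusMeasure d))
    (hv' : ∀ j, Integrable (v' · j) (torusMeasure d))
    (hB : ∀ j, ∫ x, |v' x j| ∂torusMeasure d ≤ B)
    (hE : ∀ j, ∫ x, |v x j - v' x j| ∂torusMeasure d ≤ E) (i : Fin D) :
    ∫ x, |ℓ.apply σ v x i - ℓ'.apply σ v' x i| ∂torusMeasure d ≤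
      Λ * (D * (M * E) + (modes d κ).card * (D * (2 * M * E)) +
        (D * (τ * B) + (modes d κ).card * (D * (2 * τ * B))) + τ) := by
  have hvv : ∀ j, Integrable ((v - v') · j) (torusMeasure d) := fun j => (hv j).sub (hv' j)
  have hl1 := (ℓ.integrable_linear hvv i).abs
  have hl2 := ((ℓ - ℓ').integrable_linear hv' i).abs
  have hl := ((hl1.add hl2).add (integrable_const τ)).const_mul (Λ : ℝ)
  refine (integral_mono_of_nonneg (ae_of_all _ fun _ => abs_nonneg _) hl
    (ae_of_all _ fun x => ?_)).trans ?_
  · have h := hσ.dist_le_mul (ℓ.linear v x i + ℓ.b i) (ℓ'.linear v' x i + ℓ'.b i)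
    simp only [Real.dist_eq] at h
    refine h.trans (mul_le_mul_of_nonneg_left ?_ Λ.coe_nonneg)
    have h1 : ℓ.linear v x i + ℓ.b i - (ℓ'.linear v' x i + ℓ'.b i) =
        ℓ.linear (v - v') x i + (ℓ - ℓ').linear v' x i + (ℓ.b i - ℓ'.b i) := by
      rw [← ℓ.linear_sub ℓ' hv hv']; ring
    have h2 : |ℓ.b i - ℓ'.b i| ≤ τ := hsub.2.2 i
    rw [h1]
    exact (abs_add_le _ _).trans (add_le_add (abs_add_le _ _) h2)
  · rw [integral_const_mul, integral_add' (hl1.add hl2) (integrable_const _),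
      integral_add' hl1 hl2]
    have h1 := integral_abs_linear_le hM hℓ hvv hE i
    have h2 := integral_abs_linear_le hτ hsub hv' hB i
    simp only [integral_const, probReal_univ, smul_eq_mul, one_mul]
    gcongr

/-- A layer enlarges the bound `B` of `L1Close` by a factor of at most `Y`, for the perturbation as
well as for the size; the factor `2` in the condition on `Y` accounts for the two contributions to
the perturbation, from the hidden states and from the parameters of the layer. -/
lemma L1Close.apply {σ : ℝ → ℝ} {Λ : NNReal} (hσ : LipschitzWith Λ σ)
    {ℓ ℓ' : Layer d D κ} {M τ B Y : ℝ} (hM : 1 ≤ M) (hτ : 0 ≤ τ) (hB : 1 ≤ B)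
    (hY : 2 * (Λ * (D * M + (modes d κ).card * (D * (2 * M)) + M) + |σ 0|) ≤ Y)
    (hℓ : ℓ.BoundedBy M) (hℓ' : ℓ'.BoundedBy M) (hsub : (ℓ - ℓ').BoundedBy τ)
    {v v' : UnitAddTorus (Fin d) → Fin D → ℝ} (h : L1Close τ B v v') :
    L1Close τ (Y * B) (ℓ.apply σ v) (ℓ'.apply σ v') := by
  have hM0 : 0 ≤ M := zero_le_one.trans hM
  have hΛ := Λ.coe_nonneg
  have hD : (0 : ℝ) ≤ D := D.cast_nonneg
  have hS : (0 : ℝ) ≤ (modes d κ).card := Nat.cast_nonneg _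
  have key : Λ * (D * (M * B) + (modes d κ).card * (D * (2 * M * B)) + M) + |σ 0| ≤ Y * B := by
    calc Λ * (D * (M * B) + (modes d κ).card * (D * (2 * M * B)) + M) + |σ 0|
        ≤ Λ * (D * (M * B) + (modes d κ).card * (D * (2 * M * B)) + M * B) + |σ 0| * B := by
          gcongr
          · exact le_mul_of_one_le_right hM0 hB
          · exact le_mul_of_one_le_right (abs_nonneg _) hB
      _ = (Λ * (D * M + (modes d κ).card * (D * (2 * M)) + M) + |σ 0|) * B := by ring
      _ ≤ Y * B := by
          gcongr
          refine le_trans ?_ hY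
          have : 0 ≤ Λ * (D * M + (modes d κ).card * (D * (2 * M)) + M) + |σ 0| := by positivity
          linarith
  refine ⟨ℓ.integrable_apply hσ h.int, ℓ'.integrable_apply hσ h.int',
    fun j => (Layer.integral_abs_apply_le hσ hM0 hℓ h.int h.le j).trans key,
    fun j => (Layer.integral_abs_apply_le hσ hM0 hℓ' h.int' h.le' j).trans key, fun j => ?_⟩
  refine (Layer.integral_abs_apply_sub_le hσ hM0 hτ hℓ hsub h.int h.int' h.le' h.sub_le j).trans ?_
  calc (Λ : ℝ) * (D * (M * (τ * B)) + (modes d κ).card * (D * (2 * M * (τ * B))) +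
        (D * (τ * B) + (modes d κ).card * (D * (2 * τ * B))) + τ)
      = (τ * Λ) * (D * (M * B) + (modes d κ).card * (D * (2 * M * B)) +
        (D * (1 * B) + (modes d κ).card * (D * (2 * 1 * B))) + 1 * 1) := by ring
    _ ≤ (τ * Λ) * (D * (M * B) + (modes d κ).card * (D * (2 * M * B)) +
        (D * (M * B) + (modes d κ).card * (D * (2 * M * B))) + M * B) := by gcongr
    _ ≤ (τ * Λ) * (D * (M * B) + (modes d κ).card * (D * (2 * M * B)) +
        (D * (M * B) + (modes d κ).card * (D * (2 * M * B))) + (M * B + M * B))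
        + 2 * τ * B * |σ 0| := by
          have h1 : 0 ≤ (τ * Λ) * (M * B) := by positivity
          have h2 : 0 ≤ 2 * τ * B * |σ 0| := by positivity
          linarith
    _ = τ * B * (2 * (Λ * (D * M + (modes d κ).card * (D * (2 * M)) + M) + |σ 0|)) := by ring
    _ ≤ τ * B * Y := by gcongr
    _ = τ * (Y * B) := by ring

/-- An invariant that every layer propagates holds after all `L` layers. -/
lemma foldl_rel {β : Type*} (r : ℕ → β → β → Prop) (L : ℕ) (f g : β → Fin L → β)
    {x y : β} (h0 : r 0 x y)
    (hs : ∀ (n : Fin L) v w, r n v w → r (n + 1) (f v n) (g w n)) :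
    r L (Fin.foldl L f x) (Fin.foldl L g y) := by
  induction L with
  | zero => simpa using h0
  | succ L ih =>
    rw [Fin.foldl_succ_last, Fin.foldl_succ_last]
    exact hs (Fin.last L) _ _ (ih _ _ fun n v w h => hs n.castSucc v w h)

variable {d_in : ℕ}

/-! ### Dependence of the output on the parameters -/

lemma integrable_apply_inputSpace (u : InputSpace d d_in) (j : Fin d_in) :
    Integrable (fun x => u x j) (torusMeasure d) := by
  have h : Integrable u (torusMeasure d) := (Lp.memLp u).integrable (by norm_num)
  exact (EuclideanSpace.proj (𝕜 := ℝ) j).integrable_comp h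

/-- The torus has mass one, so the `L¹` norm is at most the `L²` norm. -/
lemma integral_abs_inputSpace_le (u : InputSpace d d_in) (j : Fin d_in) :
    ∫ x, |u x j| ∂torusMeasure d ≤ ‖u‖ := by
  have h : Integrable u (torusMeasure d) := (Lp.memLp u).integrable (by norm_num)
  calc ∫ x, |u x j| ∂torusMeasure d ≤ ∫ x, ‖u x‖ ∂torusMeasure d :=
        integral_mono_of_nonneg (ae_of_all _ fun _ => abs_nonneg _) h.norm
          (ae_of_all _ fun x => PiLp.norm_apply_le (u x) j)
    _ ≤ ‖u‖ := by
        rw [integral_norm_eq_lintegral_enorm h.1, ← eLpNorm_one_eq_lintegral_enorm, Lp.norm_def]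
        exact ENNReal.toReal_mono (Lp.memLp u).2.ne
          (eLpNorm_le_eLpNorm_of_exponent_le (by norm_num) h.1)

/-- The indices of the real parameters of an architecture: lifting matrix, layers (each with weight
matrix, real and imaginary parts of the multiplier, bias), projection. -/
abbrev ParamIndex (d d_in D κ L : ℕ) : Type :=
  (Fin D × Fin d_in) ⊕
    (Fin L × ((Fin D × Fin D) ⊕ ((modes d κ × Fin D × Fin D) × Bool) ⊕ Fin D)) ⊕ Fin D

/-- The factor `2` arises because a complex entry counts as one parameter in `numParams`. -/
lemma card_paramIndex_le (Φ : FNO d d_in) :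
    Fintype.card (ParamIndex d d_in Φ.d_c Φ.κ Φ.L) ≤ 2 * Φ.numParams := by
  simp only [ParamIndex, Fintype.card_sum, Fintype.card_prod, Fintype.card_fin, Fintype.card_coe,
    Fintype.card_bool, numParams]
  generalize (modes d Φ.κ).card = m
  nlinarith [Nat.zero_le (Φ.L * Φ.d_c ^ 2), Nat.zero_le (Φ.L * Φ.d_c)]

/-- The layer with prescribed real parameters. -/
def layerOfParams {D κ : ℕ}
    (θ : (Fin D × Fin D) ⊕ ((modes d κ × Fin D × Fin D) × Bool) ⊕ Fin D → ℝ) : Layer d D κ where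
  W i j := θ (.inl (i, j))
  multiplier k i j := ⟨θ (.inr (.inl ((k, i, j), false))), θ (.inr (.inl ((k, i, j), true)))⟩
  b i := θ (.inr (.inr i))

/-- The Fourier neural operator with prescribed real parameters. -/
def ofParams (D κ L : ℕ) (θ : ParamIndex d d_in D κ L → ℝ) : FNO d d_in where
  d_c := D
  κ := κ
  L := L
  P i j := θ (.inl (i, j))
  layer n := layerOfParams fun p => θ (.inr (.inl (n, p)))
  Q i := θ (.inr (.inr i))

lemma layerOfParams_boundedBy {D κ : ℕ} {M : ℝ}
    {θ : (Fin D × Fin D) ⊕ ((modes d κ × Fin D × Fin D) × Bool) ⊕ Fin D → ℝ}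
    (h : ∀ p, |θ p| ≤ M) : (layerOfParams θ).BoundedBy M :=
  ⟨fun _ _ => h _, fun _ _ _ => ⟨h _, h _⟩, fun _ => h _⟩

lemma exists_ofParams_eq (Φ : FNO d d_in) {M : ℝ} (hΦ : Φ.BoundedBy M) :
    ∃ θ : ParamIndex d d_in Φ.d_c Φ.κ Φ.L → ℝ, (∀ p, |θ p| ≤ M) ∧ ofParams _ _ _ θ = Φ := by
  refine ⟨Sum.elim (fun p => Φ.P p.1 p.2) (Sum.elim (fun p => Sum.elim
    (fun r => (Φ.layer p.1).W r.1 r.2) (Sum.elim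
      (fun r => if r.2 then ((Φ.layer p.1).multiplier r.1.1 r.1.2.1 r.1.2.2).im
        else ((Φ.layer p.1).multiplier r.1.1 r.1.2.1 r.1.2.2).re)
      (fun i => (Φ.layer p.1).b i)) p.2) Φ.Q), ?_, rfl⟩
  rintro (p | ⟨n, p | ⟨r, _ | _⟩ | i⟩ | i)
  · exact hΦ.1 _ _
  · exact (hΦ.2.1 n).1 _ _
  · simpa using ((hΦ.2.1 n).2.1 r.1 r.2.1 r.2.2).1
  · simpa using ((hΦ.2.1 n).2.1 r.1 r.2.1 r.2.2).2
  · exact (hΦ.2.1 n).2.2 _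
  · exact hΦ.2.2 _

/-- The lifted inputs of two networks with nearby parameters are close. -/
lemma l1Close_lift {D : ℕ} {P P' : Matrix (Fin D) (Fin d_in) ℝ} {M τ Y R : ℝ}
    (hM : 1 ≤ M) (hτ : 0 ≤ τ) (hY : d_in * (M * R) ≤ Y)
    (hP : ∀ i j, |P i j| ≤ M) (hP' : ∀ i j, |P' i j| ≤ M) (hsub : ∀ i j, |P i j - P' i j| ≤ τ)
    {u : InputSpace d d_in} (hu : ‖u‖ ≤ R) :
    L1Close τ Y (fun x => P.mulVec (u x).ofLp) (fun x => P'.mulVec (u x).ofLp) := by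
  have hR : 0 ≤ R := (norm_nonneg u).trans hu
  have hint : ∀ (A : Matrix (Fin D) (Fin d_in) ℝ) (i : Fin D),
      Integrable (fun x => A.mulVec (u x).ofLp i) (torusMeasure d) := fun A i => by
    simp only [Matrix.mulVec, dotProduct]
    exact integrable_finsetSum _ fun j _ => (integrable_apply_inputSpace u j).const_mul _
  have hle : ∀ (A : Matrix (Fin D) (Fin d_in) ℝ) (m : ℝ), 0 ≤ m → (∀ i j, |A i j| ≤ m) → ∀ i,
      ∫ x, |A.mulVec (u x).ofLp i| ∂torusMeasure d ≤ d_in * (m * R) := by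
    intro A m hm hA i
    have hi : ∀ j ∈ Finset.univ, Integrable (fun x => m * |u x j|) (torusMeasure d) := fun j _ =>
      (integrable_apply_inputSpace u j).abs.const_mul m
    calc ∫ x, |A.mulVec (u x).ofLp i| ∂torusMeasure d
        ≤ ∫ x, ∑ j, m * |u x j| ∂torusMeasure d := by
          refine integral_mono_of_nonneg (ae_of_all _ fun _ => abs_nonneg _)
            (integrable_finsetSum _ hi) (ae_of_all _ fun x => ?_)
          change |∑ j, A i j * u x j| ≤ ∑ j, m * |u x j|
          refine (Finset.abs_sum_le_sum_abs _ _).trans (Finset.sum_le_sum fun j _ => ?_)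
          rw [abs_mul]
          exact mul_le_mul_of_nonneg_right (hA i j) (abs_nonneg _)
      _ = ∑ j, m * ∫ x, |u x j| ∂torusMeasure d := by
          rw [integral_finsetSum _ hi]
          simp only [integral_const_mul]
      _ ≤ ∑ _j : Fin d_in, m * R := Finset.sum_le_sum fun j _ =>
          mul_le_mul_of_nonneg_left ((integral_abs_inputSpace_le u j).trans hu) hm
      _ = d_in * (m * R) := by simp
  refine ⟨hint P, hint P', fun j => (hle P M (by linarith) hP j).trans hY,
    fun j => (hle P' M (by linarith) hP' j).trans hY, fun j => ?_⟩
  have h1 : ∀ x, P.mulVec (u x).ofLp j - P'.mulVec (u x).ofLp j =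
      (P - P').mulVec (u x).ofLp j := fun x => by rw [Matrix.sub_mulVec]; rfl
  simp only [h1]
  refine (hle (P - P') τ hτ hsub j).trans ?_
  calc (d_in : ℝ) * (τ * R) = τ * (d_in * (1 * R)) := by ring
    _ ≤ τ * (d_in * (M * R)) := by gcongr
    _ ≤ τ * Y := by gcongr

/-- The output depends Lipschitz continuously on the parameters, uniformly on bounded sets of
inputs: each layer enlarges the `L¹` size of the hidden states, and the effect of a perturbation of
size `τ` of the parameters, by a factor of at most `Y`. -/
lemma abs_eval_ofParams_sub_le {σ : ℝ → ℝ} {Λ : NNReal} (hσ : LipschitzWith Λ σ) {D κ L : ℕ}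
    {θ θ' : ParamIndex d d_in D κ L → ℝ} {M τ Y R : ℝ} (hM : 1 ≤ M) (hτ : 0 ≤ τ) (hY1 : 1 ≤ Y)
    (hYP : d_in * (M * R) ≤ Y)
    (hY : 2 * (Λ * (D * M + (modes d κ).card * (D * (2 * M)) + M) + |σ 0|) ≤ Y)
    (hθ : ∀ p, |θ p| ≤ M) (hθ' : ∀ p, |θ' p| ≤ M) (hsub : ∀ p, |θ p - θ' p| ≤ τ)
    {u : InputSpace d d_in} (hu : ‖u‖ ≤ R) :
    |(ofParams D κ L θ).eval σ u - (ofParams D κ L θ').eval σ u| ≤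
      2 * D * M * (τ * Y ^ (L + 1)) := by
  have hM0 : 0 ≤ M := by linarith
  have hclose : L1Close τ (Y ^ (L + 1)) ((ofParams D κ L θ).hidden σ u)
      ((ofParams D κ L θ').hidden σ u) := by
    refine foldl_rel (fun n => L1Close τ (Y ^ (n + 1))) L _ _ ?_ ?_
    · rw [zero_add, pow_one]
      exact l1Close_lift hM hτ hYP (fun _ _ => hθ _) (fun _ _ => hθ' _) (fun _ _ => hsub _) hu
    · intro n v w h
      rw [pow_succ']
      exact h.apply hσ hM hτ (one_le_pow₀ hY1) hY (layerOfParams_boundedBy fun _ => hθ _)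
        (layerOfParams_boundedBy fun _ => hθ' _)
        ⟨fun _ _ => hsub _, fun _ _ _ => ⟨hsub _, hsub _⟩, fun _ => hsub _⟩
  set v := (ofParams D κ L θ).hidden σ u
  set v' := (ofParams D κ L θ').hidden σ u
  set B := Y ^ (L + 1)
  have hB : 0 ≤ B := by positivity
  let Q : Fin D → ℝ := fun i => θ (.inr (.inr i))
  let Q' : Fin D → ℝ := fun i => θ' (.inr (.inr i))
  have hQ : ∀ (q : Fin D → ℝ) {w : UnitAddTorus (Fin d) → Fin D → ℝ},
      (∀ j, Integrable (w · j) (torusMeasure d)) →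
      Integrable (fun x => q ⬝ᵥ w x) (torusMeasure d) := fun q w hw =>
    integrable_finsetSum _ fun j _ => (hw j).const_mul _
  change |(⨍ x, Q ⬝ᵥ v x ∂torusMeasure d) - ⨍ x, Q' ⬝ᵥ v' x ∂torusMeasure d| ≤ _
  rw [average_eq_integral, average_eq_integral, ← integral_sub (hQ Q hclose.int)
    (hQ Q' hclose.int')]
  have hi1 : ∀ j, Integrable (fun x => M * |v x j - v' x j|) (torusMeasure d) := fun j =>
    ((hclose.int j).sub (hclose.int' j)).abs.const_mul M
  have hi2 : ∀ j, Integrable (fun x => τ * |v' x j|) (torusMeasure d) := fun j =>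
    (hclose.int' j).abs.const_mul τ
  have hi : ∀ j ∈ Finset.univ, Integrable (fun x => M * |v x j - v' x j| + τ * |v' x j|)
      (torusMeasure d) := fun j _ => (hi1 j).add (hi2 j)
  calc |∫ x, (Q ⬝ᵥ v x - Q' ⬝ᵥ v' x) ∂torusMeasure d|
      ≤ ∫ x, |Q ⬝ᵥ v x - Q' ⬝ᵥ v' x| ∂torusMeasure d := abs_integral_le_integral_abs
    _ ≤ ∫ x, ∑ j, (M * |v x j - v' x j| + τ * |v' x j|) ∂torusMeasure d := by
        refine integral_mono_of_nonneg (ae_of_all _ fun _ => abs_nonneg _)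
          (integrable_finsetSum _ hi) (ae_of_all _ fun x => ?_)
        change |∑ j, Q j * v x j - ∑ j, Q' j * v' x j| ≤ _
        rw [← Finset.sum_sub_distrib]
        refine (Finset.abs_sum_le_sum_abs _ _).trans (Finset.sum_le_sum fun j _ => ?_)
        rw [show Q j * v x j - Q' j * v' x j = Q j * (v x j - v' x j) + (Q j - Q' j) * v' x j by
          ring]
        refine (abs_add_le _ _).trans ?_
        rw [abs_mul, abs_mul]
        exact add_le_add (mul_le_mul_of_nonneg_right (hθ _) (abs_nonneg _))
          (mul_le_mul_of_nonneg_right (hsub _) (abs_nonneg _))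
    _ = ∑ j, (M * ∫ x, |v x j - v' x j| ∂torusMeasure d + τ * ∫ x, |v' x j| ∂torusMeasure d) := by
        rw [integral_finsetSum _ hi]
        refine Finset.sum_congr rfl fun j _ => ?_
        rw [integral_add (hi1 j) (hi2 j), integral_const_mul, integral_const_mul]
    _ ≤ ∑ _j : Fin D, (M * (τ * B) + τ * B) := Finset.sum_le_sum fun j _ =>
        add_le_add (mul_le_mul_of_nonneg_left (hclose.sub_le j) hM0)
          (mul_le_mul_of_nonneg_left (hclose.le' j) hτ)
    _ = D * (M * (τ * B) + 1 * (τ * B)) := by simp [mul_add]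
    _ ≤ D * (M * (τ * B) + M * (τ * B)) := by gcongr
    _ = 2 * D * M * (τ * B) := by ring

/-! ### Reduction to finitely many architectures -/

lemma le_card_modes (hd : d ≠ 0) (κ : ℕ) : κ ≤ (modes d κ).card := by
  rw [modes, Fintype.card_piFinset]
  simp only [Int.card_Ioo, Finset.prod_const, Finset.card_univ, Fintype.card_fin]
  refine le_trans ?_ (Nat.le_self_pow hd _)
  omega

lemma card_modes_zero_le (d : ℕ) : (modes d 0).card ≤ 1 := by
  rw [modes, Fintype.card_piFinset]
  refine Finset.prod_le_one' fun i _ => ?_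
  simp

/-- Over the zero-dimensional torus the Fourier cut-off can be taken to be `0`, since the retained
modes do not depend on it. -/
lemma exists_layer_cutoff_zero {D κ : ℕ} (ℓ : Layer 0 D κ) {M : ℝ} (hℓ : ℓ.BoundedBy M) :
    ∃ ℓ' : Layer 0 D 0, ℓ'.BoundedBy M ∧ ∀ σ, ℓ'.apply σ = ℓ.apply σ := by
  have h : ∀ k, k ∈ modes 0 0 ↔ k ∈ modes 0 κ := fun k => by simp [modes]
  refine ⟨⟨ℓ.W, fun k => ℓ.multiplier ⟨k.1, (h _).1 k.2⟩, ℓ.b⟩,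
    ⟨hℓ.1, fun _ => hℓ.2.1 _, hℓ.2.2⟩, fun σ => ?_⟩
  funext v x i
  have : Layer.nonlocal (⟨ℓ.W, fun k => ℓ.multiplier ⟨k.1, (h _).1 k.2⟩, ℓ.b⟩ : Layer 0 D 0) v x i
      = ℓ.nonlocal v x i := by
    simp only [Layer.nonlocal]
    congr 1
  simp only [Layer.apply, this]

/-- A network with at most `q` parameters has the same output as one whose width, cut-off and depth
are at most `q`. Only networks of width zero, of depth zero, or over the zero-dimensional torus
need to be changed. -/
lemma exists_small_architecture (σ : ℝ → ℝ) (Φ : FNO d d_in) {q : ℕ} {M : ℝ} (hq : Φ.numParams ≤ q)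
    (hΦ : Φ.BoundedBy M) :
    ∃ Ψ : FNO d d_in, Ψ.eval σ = Φ.eval σ ∧ Ψ.numParams ≤ q ∧ Ψ.BoundedBy M ∧
      Ψ.d_c ≤ q ∧ Ψ.κ ≤ q ∧ Ψ.L ≤ q ∧ (modes d Ψ.κ).card ≤ q + 1 := by
  obtain ⟨D, κ, L, P, layer, Q⟩ := Φ
  simp only [numParams] at hq
  have hDq : D ≤ q := le_trans (Nat.le_add_left _ _) hq
  rcases Nat.eq_zero_or_pos D with rfl | hD
  · refine ⟨⟨0, 0, 0, 0, Fin.elim0, 0⟩, ?_, by simp [numParams], ⟨fun i => i.elim0, fun n => n.elim0,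
      fun i => i.elim0⟩, by simp, by simp, by simp, (card_modes_zero_le d).trans (by simp)⟩
    funext u
    simp [eval, dotProduct]
  rcases Nat.eq_zero_or_pos L with rfl | hL
  · refine ⟨⟨D, 0, 0, P, Fin.elim0, Q⟩, ?_, by simpa [numParams] using hq, ⟨hΦ.1, fun n => n.elim0,
      hΦ.2.2⟩, hDq, by simp, by simp, (card_modes_zero_le d).trans (by simp)⟩
    funext u
    simp [eval, hidden]
  have hLq : L * (D ^ 2 + (modes d κ).card * D ^ 2 + D) ≤ q := by omega
  have hD2 : 0 < D ^ 2 := by positivity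
  have h1 : L ≤ q := le_trans (Nat.le_mul_of_pos_right _ (by omega)) hLq
  have h2 : (modes d κ).card ≤ q := by
    refine le_trans ?_ (le_trans (Nat.le_mul_of_pos_left _ hL) hLq)
    have := Nat.le_mul_of_pos_right (modes d κ).card hD2
    omega
  rcases Nat.eq_zero_or_pos d with rfl | hd
  · choose layer' hb happ using fun n => exists_layer_cutoff_zero (layer n) (hΦ.2.1 n)
    have hcard : (modes 0 0).card = (modes 0 κ).card := by simp [modes]
    refine ⟨⟨D, 0, L, P, layer', Q⟩, ?_, by simpa [numParams, hcard] using hq, ⟨hΦ.1, hb, hΦ.2.2⟩,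
      hDq, by simp, h1, (card_modes_zero_le 0).trans (by simp)⟩
    funext u
    simp [eval, hidden, happ]
  · exact ⟨⟨D, κ, L, P, layer, Q⟩, rfl, hq, hΦ, hDq, (le_card_modes hd.ne' κ).trans h2, h1,
      h2.trans (by simp)⟩

/-! ### Small nets for the networks with at most `q` parameters -/
/-- The outputs, on the inputs in `K`, of the networks with at most `q` parameters, all bounded by
`exp q`. -/
def networkClass (σ : ℝ → ℝ) (K : Set (InputSpace d d_in)) (q : ℕ) : Set (K → ℝ) :=
  {f | ∃ Φ : FNO d d_in, Φ.numParams ≤ q ∧ Φ.BoundedBy (Real.exp q) ∧ f = fun u : K => Φ.eval σ u}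

/-- Rounding down to multiples of `τ` changes a number by at most `τ`. -/
lemma abs_sub_mul_floor_le {τ : ℝ} (hτ : 0 < τ) (x : ℝ) : |x - τ * ⌊x / τ⌋| ≤ τ := by
  have h1 := mul_le_mul_of_nonneg_left (Int.floor_le (x / τ)) hτ.le
  have h2 := mul_le_mul_of_nonneg_left (Int.lt_floor_add_one (x / τ)).le hτ.le
  rw [mul_div_cancel₀ _ hτ.ne'] at h1 h2
  rw [abs_le]
  constructor <;> linarith

/-- The net consists of the networks whose parameters are integer multiples of a step size `τ`,
exponentially small in `q ^ 2`. -/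
lemma hasSmallNets_networkClass {σ : ℝ → ℝ} {Λ : NNReal} (hσ : LipschitzWith Λ σ)
    {K : Set (InputSpace d d_in)} (hK : Bornology.IsBounded K) :
    HasSmallNets (networkClass σ K) := by
  classical
  obtain ⟨R, hR⟩ := hK.exists_norm_le
  have hlim : Tendsto (fun q : ℕ => Real.exp q) atTop atTop :=
    Real.tendsto_exp_atTop.comp tendsto_natCast_atTop_atTop
  filter_upwards [eventually_ge_atTop 20, hlim.eventually_ge_atTop (Λ : ℝ),
    hlim.eventually_ge_atTop |σ 0|, hlim.eventually_ge_atTop (d_in : ℝ),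
    hlim.eventually_ge_atTop R] with q hq hΛ hσ0 hdin hRE
  set E := Real.exp q with hE
  have hq20 : (20 : ℝ) ≤ q := by exact_mod_cast hq
  have hqE : (q : ℝ) + 1 ≤ E := Real.add_one_le_exp _
  have hE21 : 21 ≤ E := by linarith
  have hE0 : 0 < E := by linarith
  have hE1 : 1 ≤ E := by linarith
  -- With parameters bounded by `M = 2 E` (room for rounding) and a growth factor `Y = E ^ 6` per
  -- layer, the Lipschitz constant `2 D M Y ^ (L + 1)` is at most `4 E ^ (6 q + 8)`.
  set τ : ℝ := (E ^ (6 * q + 10))⁻¹ with hτdef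
  have hτ : 0 < τ := by positivity
  have hτ1 : τ ≤ 1 := inv_le_one_of_one_le₀ (one_le_pow₀ hE1)
  set N : ℕ := ⌈E ^ (6 * q + 11)⌉₊ with hN
  let grid : (a : ℕ × ℕ × ℕ) → Finset (K → ℝ) := fun a =>
    (Fintype.piFinset fun _ : ParamIndex d d_in a.1 a.2.1 a.2.2 =>
      Finset.Icc (-(N : ℤ)) N).image fun n (u : K) =>
        (ofParams a.1 a.2.1 a.2.2 fun p => τ * n p).eval σ u
  let arch : Finset (ℕ × ℕ × ℕ) :=
    (Finset.range (q + 1) ×ˢ Finset.range (q + 1) ×ˢ Finset.range (q + 1)).filter fun a =>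
      Fintype.card (ParamIndex d d_in a.1 a.2.1 a.2.2) ≤ 2 * q
  refine ⟨arch.biUnion grid, ?_, ?_⟩
  · have hN2 : ((2 * N + 1 : ℕ) : ℝ) ≤ E ^ (6 * q + 12) := by
      have h1 : (N : ℝ) < E ^ (6 * q + 11) + 1 := Nat.ceil_lt_add_one (by positivity)
      have h2 : 1 ≤ E ^ (6 * q + 11) := one_le_pow₀ hE1
      rw [pow_succ E (6 * q + 11)]
      push_cast
      nlinarith
    have hgrid : ∀ a ∈ arch, (grid a).card ≤ (2 * N + 1) ^ (2 * q) := by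
      intro a ha
      refine Finset.card_image_le.trans ?_
      rw [Fintype.card_piFinset, Finset.prod_const, Finset.card_univ, Int.card_Icc,
        show ((N : ℤ) + 1 - -N).toNat = 2 * N + 1 by omega]
      exact Nat.pow_le_pow_right (by omega) (Finset.mem_filter.1 ha).2
    have harch : arch.card ≤ (q + 1) ^ 3 := by
      refine (Finset.card_filter_le _ _).trans_eq ?_
      simp only [Finset.card_product, Finset.card_range]
      ring
    have hcard : (arch.biUnion grid).card ≤ (q + 1) ^ 3 * (2 * N + 1) ^ (2 * q) :=
      (Finset.card_biUnion_le_card_mul _ _ _ hgrid).trans (Nat.mul_le_mul_right _ harch)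
    calc ((arch.biUnion grid).card : ℝ) ≤ ((q : ℝ) + 1) ^ 3 * ((2 * N + 1 : ℕ) : ℝ) ^ (2 * q) := by
          exact_mod_cast hcard
      _ ≤ E ^ 3 * (E ^ (6 * q + 12)) ^ (2 * q) := by gcongr
      _ = Real.exp (q * (3 + (6 * q + 12) * (2 * q))) := by
          rw [← pow_mul, ← pow_add, hE, ← Real.exp_nat_mul]
          congr 1
          push_cast
          ring
      _ ≤ Real.exp ((q : ℝ) ^ 4) := by
          refine Real.exp_le_exp.2 ?_
          have h3 : (20 : ℝ) * q ^ 2 ≤ q ^ 3 := by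
            rw [pow_succ (q : ℝ) 2, mul_comm]; gcongr
          have h4 : (20 : ℝ) * q ^ 3 ≤ q ^ 4 := by
            rw [pow_succ (q : ℝ) 3, mul_comm]; gcongr
          nlinarith
  · rintro f ⟨Φ, hΦq, hΦb, rfl⟩
    obtain ⟨Ψ, heval, hΨq, hΨb, hD, hκ, hL, hmodes⟩ := exists_small_architecture σ Φ hΦq hΦb
    have hidx := (card_paramIndex_le Ψ).trans (Nat.mul_le_mul_left 2 hΨq)
    obtain ⟨θ, hθ, hθΨ⟩ := exists_ofParams_eq Ψ hΨb
    rw [← heval, ← hθΨ]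
    -- Only the sizes of the architecture of `Ψ` matter from here on.
    generalize Ψ.d_c = D at *
    generalize Ψ.κ = κ at *
    generalize Ψ.L = L at *
    let n : ParamIndex d d_in D κ L → ℤ := fun p => ⌊θ p / τ⌋
    have hn : ∀ p, n p ∈ Finset.Icc (-(N : ℤ)) N := by
      intro p
      have h1 : |θ p / τ| ≤ N := by
        rw [abs_div, abs_of_pos hτ, hτdef, div_inv_eq_mul]
        calc |θ p| * E ^ (6 * q + 10) ≤ E * E ^ (6 * q + 10) := by gcongr; exact hθ p
          _ = E ^ (6 * q + 11) := by ring
          _ ≤ N := Nat.le_ceil _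
      have h2 := abs_le.1 h1
      rw [Finset.mem_Icc]
      refine ⟨Int.le_floor.2 (by push_cast; exact h2.1), ?_⟩
      have : (⌊θ p / τ⌋ : ℝ) ≤ N := (Int.floor_le _).trans h2.2
      exact_mod_cast this
    have hsub : ∀ p, |θ p - τ * n p| ≤ τ := fun p => abs_sub_mul_floor_le hτ (θ p)
    refine ⟨fun u : K => (ofParams D κ L fun p => τ * n p).eval σ u, ?_, fun u => ?_⟩
    · refine Finset.mem_biUnion.2 ⟨(D, κ, L), ?_, ?_⟩
      · simp only [arch, Finset.mem_filter, Finset.mem_product, Finset.mem_range]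
        exact ⟨⟨by omega, by omega, by omega⟩, hidx⟩
      · exact Finset.mem_image.2 ⟨n, Fintype.mem_piFinset.2 hn, rfl⟩
    · have hDE : (D : ℝ) ≤ E := by
        have : (D : ℝ) ≤ q := by exact_mod_cast hD
        linarith
      have hmE : ((modes d κ).card : ℝ) ≤ E := by
        have : ((modes d κ).card : ℝ) ≤ q + 1 := by exact_mod_cast hmodes
        linarith
      have hR0 : 0 ≤ R := (norm_nonneg _).trans (hR u u.2)
      have hY1 : (1 : ℝ) ≤ E ^ 6 := one_le_pow₀ hE1
      have hE56 : 21 * E ^ 5 ≤ E ^ 6 := by rw [pow_succ E 5, mul_comm]; gcongr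
      have hpow : ∀ m ≤ 5, E ^ m ≤ E ^ 5 := fun m hm => pow_le_pow_right₀ hE1 hm
      have hYP : d_in * (2 * E * R) ≤ E ^ 6 := by
        calc (d_in : ℝ) * (2 * E * R) ≤ E * (2 * E * E) := by gcongr
          _ = 2 * E ^ 3 := by ring
          _ ≤ E ^ 6 := by linarith [hpow 3 (by norm_num), pow_pos hE0 5]
      have hY : 2 * (Λ * (D * (2 * E) + (modes d κ).card * (D * (2 * (2 * E))) + 2 * E) + |σ 0|) ≤
          E ^ 6 := by
        calc 2 * (Λ * (D * (2 * E) + (modes d κ).card * (D * (2 * (2 * E))) + 2 * E) + |σ 0|)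
            ≤ 2 * (E * (E * (2 * E) + E * (E * (2 * (2 * E))) + 2 * E) + E) := by gcongr
          _ = 4 * E ^ 3 + 8 * E ^ 4 + 4 * E ^ 2 + 2 * E ^ 1 := by ring
          _ ≤ E ^ 6 := by
              linarith [hpow 1 (by norm_num), hpow 2 (by norm_num), hpow 3 (by norm_num),
                hpow 4 (by norm_num), pow_pos hE0 5]
      have hmain := abs_eval_ofParams_sub_le hσ (θ := θ) (θ' := fun p => τ * n p) (M := 2 * E)
        (by linarith) hτ.le hY1 hYP hY (fun p => (hθ p).trans (by linarith)) (fun p => by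
          have h1 := abs_sub_abs_le_abs_sub (τ * n p) (θ p)
          rw [abs_sub_comm] at h1
          linarith [hsub p, hθ p]) hsub (hR u u.2)
      refine hmain.trans ?_
      have hYL : (E ^ 6) ^ (L + 1) ≤ E ^ (6 * q + 6) := by
        rw [← pow_mul]
        exact pow_le_pow_right₀ hE1 (by omega)
      calc 2 * D * (2 * E) * (τ * (E ^ 6) ^ (L + 1))
          ≤ 2 * E * (2 * E) * (τ * E ^ (6 * q + 6)) := by gcongr
        _ = 4 * (E ^ 2)⁻¹ := by
            rw [hτdef, show E ^ (6 * q + 10) = E ^ (6 * q + 6) * E ^ 4 by ring]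
            field_simp
            ring
        _ ≤ E * (E ^ 2)⁻¹ := by gcongr; linarith
        _ = E⁻¹ := by field_simp
        _ = Real.exp (-(q : ℝ)) := (Real.exp_neg _).symm

end FNO

end

/-- For a compact set `K ⊂ L²(𝕋^d; ℝ^{d_in})` whose metric entropy is at least
of order `ε^(-1/α)` as `ε → 0`, and a fixed Lipschitz activation function, the generic
`G ∈ Lip₁(K)` cannot be approximated by FNOs at the logarithmic rate `γ`, for any `γ > α`. -/
theorem mainTheorem9 (d d_in : ℕ) (σ : ℝ → ℝ) (hσ : ∃ Λ : NNReal, LipschitzWith Λ σ)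
    (K : Set (FNO.InputSpace d d_in)) (hK : IsCompact K) (α : ℝ) (hα : 0 < α)
    (hent : ∃ c : ℝ, 0 < c ∧
      ∀ᶠ ε : ℝ in 𝓝[>] 0, c * ε ^ (-(1 / α)) ≤ FNO.metricEntropy K ε) :
    ∀ᶠ G : FNO.lipOne K in residual (FNO.lipOne K),
      ∀ γ : ℝ, α < γ → ¬ FNO.ApproximableAtLogRate σ K (G : C(K, ℝ)) γ := by
  obtain ⟨Λ, hσ⟩ := hσ
  filter_upwards [FNO.eventually_residual_not_approximable hK hα hent
    (FNO.hasSmallNets_networkClass hσ hK.isBounded)] with G hG γ hγ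
  rintro ⟨Φ, hΦ, C, hC⟩
  refine hG γ hγ C ?_
  filter_upwards [hΦ, hC] with q hq hqC
  exact ⟨_, ⟨Φ q, hq.1, hq.2, rfl⟩, hqC⟩
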